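/- All graphs are finite and simple. For a set $S$ of vertices of a connected graph $G$, the Steiner distance $d(S)$ is the minimum number of edges of a connected subgraph of $G$ containing all vertices of $S$, and the Steiner $3$-Wiener index of $G$ is $$SW_3(G)=\sum_{S\subseteq V(G),\ |S|=3} d(S).$$ Let $Q_n$ be the graph on the binary strings of length $n$, two strings being adjacent if they differ in precisely one place. For $n\ge 0$, the Fibonacci cube $\Gamma_n$ is the subgraph of $Q_n$ induced by the strings $b_1\ldots b_n$ with $b_ib_{i+1}=0$ for $1\le i<n$ (so $\Gamma_0=K_1$). For $n\ge 1$, the Lucas cube $\Lambda_n$ is the subgraph of $\Gamma_n$ induced by the strings that moreover satisfy $b_1b_n=0$ (so $\Lambda_1=K_1$). Let $F_0=0$, $F_1=1$, $F_n=F_{n-1}+F_{n-2}$ for $n\ge 2$, and $L_0=2$, $L_1=1$, $L_n=L_{n-1}+L_{n-2}$ for $n\ge2$. Then all the graphs $\Gamma_n$ ($n\ge 0$) and $\Lambda_n$ ($n\ge 1$) are connected, and: (i) for every $n\ge 0$, $$SW_3(\Gamma_n)=\frac1{50}\,(F_{n+2}-2)\left(4(n+1)F_n^2+(9n+2)F_nF_{n+1}+6nF_{n+1}^2\right);$$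 (ii) for every $n\ge 1$, $$SW_3(\Lambda_n)=\frac n2\,F_{n-1}F_{n+1}\,(L_n-2).$$ -/

import Mathlib

/-- The Steiner distance of a set `S` of vertices of a connected graph `G`: the minimum number of
edges of a connected subgraph of `G` containing all the vertices of `S`. -/
noncomputable def steinerDist {V : Type*} (G : SimpleGraph V) (S : Set V) : ℕ :=
  sInf {m : ℕ | ∃ H : G.Subgraph, H.Connected ∧ S ⊆ H.verts ∧ H.edgeSet.ncard = m}

/-- The Steiner `k`-Wiener index of a finite connected graph: the sum of the Steiner distances of
all `k`-element sets of vertices. -/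
noncomputable def steinerWienerIndex {V : Type*} [Fintype V] (k : ℕ) (G : SimpleGraph V) : ℕ :=
  ∑ S ∈ Finset.powersetCard k (Finset.univ : Finset V), steinerDist G (S : Set V)

/-- The `n`-cube: its vertices are the binary strings of length `n`, two of them being adjacent if
they differ in precisely one place. -/
def nCube (n : ℕ) : SimpleGraph (Fin n → Bool) where
  Adj u v := hammingDist u v = 1
  symm := ⟨fun u v h => by rw [hammingDist_comm]; exact h⟩
  loopless := ⟨fun u h => by simp at h⟩

/-- A Fibonacci string: a binary string without two consecutive ones. -/
def IsFibonacciString {n : ℕ} (b : Fin n → Bool) : Prop :=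
  ∀ i j : Fin n, (j : ℕ) = (i : ℕ) + 1 → ¬(b i = true ∧ b j = true)

/-- A Lucas string: a Fibonacci string whose first and last bits are not both one.
For `n = 1` the first and the last bit coincide, so that only the string `0` qualifies;
for `n = 0` the empty string qualifies. -/
def IsLucasString {n : ℕ} (b : Fin n → Bool) : Prop :=
  IsFibonacciString b ∧
    ∀ i j : Fin n, (i : ℕ) = 0 → (j : ℕ) + 1 = n → ¬(b i = true ∧ b j = true)

instance isFibonacciStringDecidable {n : ℕ} :
    DecidablePred (fun b : Fin n → Bool => IsFibonacciString b) := fun b => by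
  unfold IsFibonacciString; infer_instance

instance isLucasStringDecidable {n : ℕ} :
    DecidablePred (fun b : Fin n → Bool => IsLucasString b) := fun b => by
  unfold IsLucasString; infer_instance

/-- The Fibonacci cube `Γ_n`. -/
def fibonacciCube (n : ℕ) : SimpleGraph {b : Fin n → Bool | IsFibonacciString b} :=
  (nCube n).induce {b | IsFibonacciString b}

/-- The Lucas cube `Λ_n`. -/
def lucasCube (n : ℕ) : SimpleGraph {b : Fin n → Bool | IsLucasString b} :=
  (nCube n).induce {b | IsLucasString b}

/-- The Lucas numbers. -/
def lucasNumber : ℕ → ℕ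
  | 0 => 2
  | 1 => 1
  | n + 2 => lucasNumber (n + 1) + lucasNumber n

/-! Both families are down-closed and closed under majority, and this alone makes the Steiner
distance of three vertices equal to the number of coordinates in which they are not all equal
(`steinerDist_eq_spread`). For the lower bound, a connected subgraph needs an edge in each such
direction. For the upper bound, geodesics from the three vertices to their majority use one step per
such coordinate in total. Summing over triples and exchanging the sums, coordinate `i` contributes
`a c (a + c - 2) / 2`, where `a` and `c` count the vertices with bit `i` equal to one and to zero
(`two_mul_steinerWienerIndex_three`). For `Γ_n`, both counts are products of two Fibonacci numbers
and `a + c = F_{n+2}` factors out, leaving a convolution (`sum_fib_mul_fib_convolution`). For `Λ_n`,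
rotation makes all coordinates alike, with `a = F_{n-1}`, `c = F_{n+1}` and `a + c = L_n`. -/

/-- The bitwise majority of three binary strings. -/
def majority {n : ℕ} (x y z : Fin n → Bool) : Fin n → Bool :=
  fun i => (x i && y i) || (x i && z i) || (y i && z i)

/-! ### Steiner distance of three vertices -/

/-- In a subgraph of the `n`-cube induced by a down-closed set of strings, any two vertices are
joined by a walk whose length is their Hamming distance. -/
theorem exists_walk_length_eq_hammingDist {n : ℕ} {P : Set (Fin n → Bool)}
    (hdown : ∀ x y, y ∈ P → (∀ i, x i = true → y i = true) → x ∈ P) :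
    ∀ (k : ℕ) (x y : P), hammingDist x.1 y.1 = k →
      ∃ w : ((nCube n).induce P).Walk x y, w.length = k := by
  have hdrop : ∀ (x : P) (i : Fin n), Function.update x.1 i false ∈ P := by
    intro x i
    refine hdown _ x.1 x.2 fun j hj => ?_
    by_cases hji : j = i
    · subst hji; simp at hj
    · simpa [Function.update_of_ne hji] using hj
  have hadj : ∀ (x : P) (i : Fin n), x.1 i = true →
      ((nCube n).induce P).Adj x ⟨Function.update x.1 i false, hdrop x i⟩ := by
    intro x i hi
    change hammingDist x.1 (Function.update x.1 i false) = 1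
    unfold hammingDist
    rw [Finset.card_eq_one]
    refine ⟨i, ?_⟩
    ext j
    by_cases hji : j = i
    · subst hji; simp [hi]
    · simp [hji]
  have hcard : ∀ (x y : Fin n → Bool) (i : Fin n), x i = true → y i = false →
      hammingDist (Function.update x i false) y + 1 = hammingDist x y := by
    intro x y i hx hy
    unfold hammingDist
    rw [← Finset.card_insert_of_notMem (a := i)]
    · congr 1
      ext j
      by_cases hji : j = i
      · subst hji; simp [hx, hy]
      · simp [hji]
    · simp [hy]
  intro k
  induction k with
  | zero =>
    intro x y h
    have hxy : x = y := Subtype.ext (hammingDist_eq_zero.1 h)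
    subst hxy
    exact ⟨SimpleGraph.Walk.nil, rfl⟩
  | succ k ih =>
    intro x y h
    have hne : x.1 ≠ y.1 := by
      intro he
      rw [he, hammingDist_self] at h
      omega
    obtain ⟨i, hi⟩ := Function.ne_iff.1 hne
    -- The endpoint with a one at `i` is the one that moves, so bits are only switched off and
    -- down-closure keeps the walk in `P`.
    cases hx : x.1 i with
    | true =>
      have hy : y.1 i = false := by
        cases hy : y.1 i with
        | true => exact absurd (hx.trans hy.symm) hi
        | false => rfl
      have h1 := hcard x.1 y.1 i hx hy
      obtain ⟨w, hw⟩ := ih ⟨Function.update x.1 i false, hdrop x i⟩ y (by simp only; omega)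
      exact ⟨SimpleGraph.Walk.cons (hadj x i hx) w, by simp [hw]⟩
    | false =>
      have hy : y.1 i = true := by
        cases hy : y.1 i with
        | false => exact absurd (hx.trans hy.symm) hi
        | true => rfl
      have h1 := hcard y.1 x.1 i hy hx
      rw [hammingDist_comm y.1 x.1] at h1
      obtain ⟨w, hw⟩ := ih x ⟨Function.update y.1 i false, hdrop y i⟩
        (by rw [hammingDist_comm]; simp only; omega)
      exact ⟨w.concat (hadj y i hy).symm, by simp [hw]⟩

theorem induce_nCube_connected {n : ℕ} {P : Set (Fin n → Bool)}
    (hdown : ∀ x y, y ∈ P → (∀ i, x i = true → y i = true) → x ∈ P) (hne : P.Nonempty) :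
    ((nCube n).induce P).Connected := by
  rw [SimpleGraph.connected_iff]
  refine ⟨fun x y => ?_, hne.to_subtype⟩
  obtain ⟨w, -⟩ := exists_walk_length_eq_hammingDist hdown _ x y rfl
  exact ⟨w⟩

/-- The number of coordinates in which the strings of a set are not all equal. -/
noncomputable def spread {n : ℕ} {P : Set (Fin n → Bool)} (S : Set P) : ℕ := by
  classical
  exact (Finset.univ.filter fun i : Fin n => ∃ u ∈ S, ∃ v ∈ S, u.1 i ≠ v.1 i).card

theorem exists_edge_of_ne {n : ℕ} {P : Set (Fin n → Bool)} {H : ((nCube n).induce P).Subgraph}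
    (hH : H.Connected) {u v : P} (hu : u ∈ H.verts) (hv : v ∈ H.verts) {i : Fin n}
    (h : u.1 i ≠ v.1 i) : ∃ a b : P, H.Adj a b ∧ a.1 i ≠ b.1 i := by
  by_contra! hcon
  obtain ⟨w⟩ := hH.preconnected.coe ⟨u, hu⟩ ⟨v, hv⟩
  have key : ∀ a b : H.verts, H.coe.Walk a b → a.1.1 i = b.1.1 i := by
    intro a b w
    induction w with
    | nil => rfl
    | cons hadj _ ih => exact (hcon _ _ hadj).trans ih
  exact h (key _ _ w)

/-- Each non-constant coordinate is flipped by some edge of `H`, and an edge of the cube flips only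
one coordinate, so these edges are distinct. -/
theorem spread_le_ncard_edgeSet {n : ℕ} {P : Set (Fin n → Bool)} {S : Set P}
    {H : ((nCube n).induce P).Subgraph} (hH : H.Connected) (hS : S ⊆ H.verts) :
    spread S ≤ H.edgeSet.ncard := by
  classical
  have hex : ∀ i : Fin n, (∃ u ∈ S, ∃ v ∈ S, u.1 i ≠ v.1 i) →
      ∃ p : P × P, H.Adj p.1 p.2 ∧ p.1.1 i ≠ p.2.1 i := by
    rintro i ⟨u, hu, v, hv, h⟩
    obtain ⟨a, b, hab, hi⟩ := exists_edge_of_ne hH (hS hu) (hS hv) h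
    exact ⟨(a, b), hab, hi⟩
  -- Supplies `choose!` with a default pair for the coordinates on which `S` is constant.
  have : Nonempty P := ⟨hH.nonempty.some⟩
  choose! p hp using hex
  rw [Set.ncard_eq_toFinset_card H.edgeSet (Set.toFinite _)]
  refine Finset.card_le_card_of_injOn (fun i => s((p i).1, (p i).2)) ?_ ?_
  · intro i hi
    simp only [Finset.coe_filter, Finset.mem_univ, true_and, Set.mem_ofPred_eq] at hi
    simpa using (hp i hi).1
  · intro i hi j hj hij
    simp only [Finset.coe_filter, Finset.mem_univ, true_and, Set.mem_ofPred_eq] at hi hj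
    have hi' := (hp i hi).2
    have hj' := (hp j hj).2
    have hone : hammingDist (p i).1.1 (p i).2.1 = 1 := (hp i hi).1.adj_sub
    unfold hammingDist at hone
    obtain ⟨k, hk⟩ := Finset.card_eq_one.1 hone
    have hdir : ∀ l, (p i).1.1 l ≠ (p i).2.1 l → l = k := by
      intro l hl
      have : l ∈ ({k} : Finset (Fin n)) := by rw [← hk]; simpa using hl
      simpa using this
    have hj'' : (p i).1.1 j ≠ (p i).2.1 j := by
      rcases Sym2.eq_iff.1 hij with ⟨h1, h2⟩ | ⟨h1, h2⟩
      · rw [h1, h2]; exact hj'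
      · rw [h1, h2]; exact hj'.symm
    rw [hdir i hi', hdir j hj'']

theorem ncard_edgeSet_toSubgraph_le {V : Type*} {G : SimpleGraph V} {u v : V} (w : G.Walk u v) :
    w.toSubgraph.edgeSet.ncard ≤ w.length := by
  classical
  rw [SimpleGraph.Walk.edgeSet_toSubgraph, ← SimpleGraph.Walk.length_edges]
  have : {e | e ∈ w.edges} = (w.edges.toFinset : Set (Sym2 V)) := by ext; simp
  change Set.ncard {e | e ∈ w.edges} ≤ _
  rw [this, Set.ncard_coe_finset]
  exact List.toFinset_card_le _

/-- The Steiner distance of three vertices in a subgraph of the `n`-cube induced by a down-closed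
set of strings that is closed under bitwise majority. -/
theorem steinerDist_eq_spread {n : ℕ} {P : Set (Fin n → Bool)}
    (hdown : ∀ x y, y ∈ P → (∀ i, x i = true → y i = true) → x ∈ P)
    (hmaj : ∀ x y z, x ∈ P → y ∈ P → z ∈ P → majority x y z ∈ P) (x y z : P) :
    steinerDist ((nCube n).induce P) {x, y, z} = spread {x, y, z} := by
  classical
  obtain ⟨m, hm⟩ : ∃ m : P, m.1 = majority x.1 y.1 z.1 := ⟨⟨_, hmaj _ _ _ x.2 y.2 z.2⟩, rfl⟩
  obtain ⟨wx, hwx⟩ := exists_walk_length_eq_hammingDist hdown _ x m rfl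
  obtain ⟨wy, hwy⟩ := exists_walk_length_eq_hammingDist hdown _ y m rfl
  obtain ⟨wz, hwz⟩ := exists_walk_length_eq_hammingDist hdown _ z m rfl
  have hxm : m ∈ wx.toSubgraph.verts := wx.end_mem_verts_toSubgraph
  have hym : m ∈ wy.toSubgraph.verts := wy.end_mem_verts_toSubgraph
  have hzm : m ∈ wz.toSubgraph.verts := wz.end_mem_verts_toSubgraph
  let H := wx.toSubgraph ⊔ wy.toSubgraph ⊔ wz.toSubgraph
  have hH : H.Connected :=
    SimpleGraph.Subgraph.connected_sup
      (SimpleGraph.Subgraph.connected_sup wx.toSubgraph_connected.preconnected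
        wy.toSubgraph_connected.preconnected ⟨m, hxm, hym⟩).preconnected
      wz.toSubgraph_connected.preconnected ⟨m, Or.inl hxm, hzm⟩
  have hS : ({x, y, z} : Set P) ⊆ H.verts := by
    rintro a (rfl | rfl | rfl)
    · exact Or.inl (Or.inl wx.start_mem_verts_toSubgraph)
    · exact Or.inl (Or.inr wy.start_mem_verts_toSubgraph)
    · exact Or.inr wz.start_mem_verts_toSubgraph
  have hle : H.edgeSet.ncard ≤ spread {x, y, z} := by
    have h1 : H.edgeSet.ncard ≤ hammingDist x.1 m.1 + hammingDist y.1 m.1 + hammingDist z.1 m.1 := by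
      rw [SimpleGraph.Subgraph.edgeSet_sup, SimpleGraph.Subgraph.edgeSet_sup, ← hwx, ← hwy, ← hwz]
      exact (Set.ncard_union_le _ _).trans (Nat.add_le_add ((Set.ncard_union_le _ _).trans
        (Nat.add_le_add (ncard_edgeSet_toSubgraph_le _) (ncard_edgeSet_toSubgraph_le _)))
        (ncard_edgeSet_toSubgraph_le _))
    refine h1.trans ?_
    unfold hammingDist spread
    simp only [Finset.card_filter]
    rw [← Finset.sum_add_distrib, ← Finset.sum_add_distrib]
    refine Finset.sum_le_sum fun i _ => ?_
    simp only [hm, majority, Set.mem_insert_iff, Set.mem_singleton_iff, exists_eq_or_imp,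
      exists_eq_left]
    -- If three bits are not all equal, exactly one of them differs from the majority.
    cases x.1 i <;> cases y.1 i <;> cases z.1 i <;> simp
  unfold steinerDist
  refine le_antisymm (le_trans (Nat.sInf_le ?_) hle)
    (le_csInf ⟨H.edgeSet.ncard, H, hH, hS, rfl⟩ ?_)
  · exact ⟨H, hH, hS, rfl⟩
  rintro k ⟨K, hK, hKS, rfl⟩
  exact spread_le_ncard_edgeSet hK hKS

/-! ### Counting triples coordinate by coordinate -/

theorem cast_choose_three (a : ℕ) :
    (a.choose 3 : ℚ) = (a : ℚ) * ((a : ℚ) - 1) * ((a : ℚ) - 2) / 6 := by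
  induction a with
  | zero => simp
  | succ a ih =>
    rw [Nat.choose_succ_succ' a 2]
    push_cast
    rw [ih, Nat.cast_choose_two]
    ring

/-- Complementary counting: `C(a+c,3) - C(a,3) - C(c,3) = a c (a + c - 2) / 2`. -/
theorem two_mul_card_nonconstant_triples {V : Type*} [Fintype V] [DecidableEq V] (f : V → Bool)
    (a c : ℕ) (ha : (Finset.univ.filter fun v => f v = true).card = a)
    (hc : (Finset.univ.filter fun v => f v = false).card = c) :
    2 * (((Finset.powersetCard 3 (Finset.univ : Finset V)).filter
      fun S => ∃ u ∈ S, ∃ v ∈ S, f u ≠ f v).card : ℚ) = a * c * ((a : ℚ) + c - 2) := by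
  have hN : (Finset.univ : Finset V).card = a + c := by
    rw [← ha, ← hc, ← Finset.card_filter_add_card_filter_not (s := Finset.univ)
      (fun v => f v = true)]
    simp
  have hcompl : ((Finset.powersetCard 3 (Finset.univ : Finset V)).filter
      fun S => ¬ ∃ u ∈ S, ∃ v ∈ S, f u ≠ f v) =
      Finset.powersetCard 3 (Finset.univ.filter fun v => f v = true) ∪
        Finset.powersetCard 3 (Finset.univ.filter fun v => f v = false) := by
    ext S
    simp only [Finset.mem_filter, Finset.mem_union, Finset.mem_powersetCard, Finset.subset_iff,
      Finset.mem_univ, true_and, implies_true]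
    constructor
    · rintro ⟨h3, hcon⟩
      push Not at hcon
      obtain ⟨u, hu⟩ : S.Nonempty := Finset.card_pos.1 (by omega)
      cases hfu : f u with
      | true => exact Or.inl ⟨fun v hv => (hcon v hv u hu).trans hfu, h3⟩
      | false => exact Or.inr ⟨fun v hv => (hcon v hv u hu).trans hfu, h3⟩
    · rintro (⟨h, h3⟩ | ⟨h, h3⟩)
      · exact ⟨h3, fun ⟨u, hu, v, hv, hne⟩ => hne ((h hu).trans (h hv).symm)⟩
      · exact ⟨h3, fun ⟨u, hu, v, hv, hne⟩ => hne ((h hu).trans (h hv).symm)⟩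
  have hdisj : Disjoint (Finset.powersetCard 3 (Finset.univ.filter fun v => f v = true))
      (Finset.powersetCard 3 (Finset.univ.filter fun v => f v = false)) := by
    rw [Finset.disjoint_left]
    intro S h1 h2
    rw [Finset.mem_powersetCard] at h1 h2
    obtain ⟨u, hu⟩ : S.Nonempty := Finset.card_pos.1 (by omega)
    have e1 := (Finset.mem_filter.1 (h1.1 hu)).2
    have e2 := (Finset.mem_filter.1 (h2.1 hu)).2
    rw [e1] at e2
    cases e2
  have h := Finset.card_filter_add_card_filter_not
    (s := Finset.powersetCard 3 (Finset.univ : Finset V)) (fun S => ∃ u ∈ S, ∃ v ∈ S, f u ≠ f v)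
  rw [hcompl, Finset.card_union_of_disjoint hdisj] at h
  simp only [Finset.card_powersetCard, hN, ha, hc] at h
  have hq := congrArg (Nat.cast : ℕ → ℚ) h
  push_cast [cast_choose_three] at hq
  linear_combination 2 * hq

/-- The Steiner `3`-Wiener index of a subgraph of the `n`-cube induced by a down-closed set of
strings that is closed under bitwise majority, in terms of the numbers `a i` and `c i` of strings
with a one, respectively a zero, at position `i`. -/
theorem two_mul_steinerWienerIndex_three {n : ℕ} {P : Set (Fin n → Bool)} [Fintype P]
    (hdown : ∀ x y, y ∈ P → (∀ i, x i = true → y i = true) → x ∈ P)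
    (hmaj : ∀ x y z, x ∈ P → y ∈ P → z ∈ P → majority x y z ∈ P) (a c : Fin n → ℕ)
    (ha : ∀ i, Nat.card {b // b ∈ P ∧ b i = true} = a i)
    (hc : ∀ i, Nat.card {b // b ∈ P ∧ b i = false} = c i) :
    2 * (steinerWienerIndex 3 ((nCube n).induce P) : ℚ) =
      ∑ i, (a i : ℚ) * c i * ((a i : ℚ) + c i - 2) := by
  classical
  have hcard : ∀ (i : Fin n) (t : Bool), (Finset.univ.filter fun v : P => v.1 i = t).card =
      Nat.card {b // b ∈ P ∧ b i = t} := by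
    intro i t
    rw [← Fintype.card_subtype, ← Nat.card_eq_fintype_card]
    exact Nat.card_congr (Equiv.subtypeSubtypeEquivSubtypeInter (fun b => b ∈ P) fun b => b i = t)
  have hS : ∀ S ∈ Finset.powersetCard 3 (Finset.univ : Finset P),
      steinerDist ((nCube n).induce P) (S : Set P) =
        ∑ i : Fin n, if ∃ u ∈ S, ∃ v ∈ S, u.1 i ≠ v.1 i then 1 else 0 := by
    intro S hS
    obtain ⟨x, y, z, -, -, -, rfl⟩ := Finset.card_eq_three.1 (Finset.mem_powersetCard.1 hS).2
    have h := steinerDist_eq_spread hdown hmaj x y z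
    rw [spread, Finset.card_filter] at h
    push_cast
    rw [h]
    simp
  unfold steinerWienerIndex
  rw [Finset.sum_congr rfl hS, Finset.sum_comm]
  push_cast
  rw [Finset.mul_sum]
  refine Finset.sum_congr rfl fun i _ => ?_
  rw [← two_mul_card_nonconstant_triples (fun v : P => v.1 i) (a i) (c i)
    ((hcard i true).trans (ha i)) ((hcard i false).trans (hc i)), Finset.card_filter]
  push_cast
  rfl

/-! ### Counting Fibonacci strings -/

theorem isFibonacciString_cons_iff {n : ℕ} (t : Bool) (b : Fin n → Bool) :
    IsFibonacciString (Fin.cons t b : Fin (n + 1) → Bool) ↔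
      IsFibonacciString b ∧ (t = true → ∀ i : Fin n, (i : ℕ) = 0 → b i = false) := by
  constructor
  · intro h
    refine ⟨fun i j hij => ?_, fun ht i hi => ?_⟩
    · simpa using h i.succ j.succ (by simp [hij])
    · simpa [ht] using h 0 i.succ (by simp [hi])
  · rintro ⟨h, h0⟩ i j hij
    obtain ⟨j, rfl⟩ : ∃ k, j = Fin.succ k :=
      ⟨j.pred (fun h => by rw [h] at hij; simp at hij), by simp⟩
    refine Fin.cases (fun hij => ?_) (fun i hij => ?_) i hij
    · rintro ⟨ht, hj⟩
      have := h0 (by simpa using ht) j (by simpa using hij)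
      simp [this] at hj
    · simpa using h i j (by simpa using hij)

theorem card_subtype_fin_succ {n : ℕ} (P : (Fin (n + 1) → Bool) → Prop) :
    Nat.card {b // P b} = Nat.card {b : Fin n → Bool // P (Fin.cons false b)} +
      Nat.card {b : Fin n → Bool // P (Fin.cons true b)} := by
  classical
  simp only [Nat.card_eq_fintype_card, Fintype.card_subtype, Finset.card_filter]
  rw [← (Fin.consEquiv fun _ : Fin (n + 1) => Bool).sum_comp, Fintype.sum_prod_type,
    Fintype.sum_bool, add_comm]
  rfl

/-- The number of Fibonacci strings of length `n` with property `P`. -/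
noncomputable def fibCard (n : ℕ) (P : (Fin n → Bool) → Prop) : ℕ :=
  Nat.card {b : Fin n → Bool // IsFibonacciString b ∧ P b}

/-- The first bit, if there is one, is zero. -/
def FirstZero {n : ℕ} (b : Fin n → Bool) : Prop := ∀ i : Fin n, (i : ℕ) = 0 → b i = false

/-- The last bit, if there is one, is zero. -/
def LastZero {n : ℕ} (b : Fin n → Bool) : Prop := ∀ i : Fin n, (i : ℕ) + 1 = n → b i = false

theorem firstZero_cons_iff {n : ℕ} (t : Bool) (b : Fin n → Bool) :
    FirstZero (Fin.cons t b : Fin (n + 1) → Bool) ↔ t = false :=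
  ⟨fun h => by simpa using h 0 rfl, fun h i hi => by
    have : i = 0 := Fin.ext hi
    subst this; simpa using h⟩

theorem lastZero_cons_iff {n : ℕ} (t : Bool) (b : Fin (n + 1) → Bool) :
    LastZero (Fin.cons t b : Fin (n + 2) → Bool) ↔ LastZero b := by
  constructor
  · intro h i hi
    simpa using h i.succ (by simp [hi])
  · intro h i
    refine Fin.cases (fun hi => ?_) (fun i hi => ?_) i
    · simp at hi
    · simpa using h i (by simpa using hi)

theorem fibCard_false {n : ℕ} {P : (Fin n → Bool) → Prop} (h : ∀ b, ¬ P b) : fibCard n P = 0 := by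
  have : IsEmpty {b : Fin n → Bool // IsFibonacciString b ∧ P b} := ⟨fun b => h _ b.2.2⟩
  exact Nat.card_of_isEmpty

theorem fibCard_succ {n : ℕ} (P : (Fin (n + 1) → Bool) → Prop) :
    fibCard (n + 1) P = fibCard n (fun b => P (Fin.cons false b)) +
      fibCard n (fun b => FirstZero b ∧ P (Fin.cons true b)) := by
  unfold fibCard
  rw [card_subtype_fin_succ]
  simp [isFibonacciString_cons_iff, FirstZero, and_assoc]

theorem fibCard_succ_firstZero {n : ℕ} (P : (Fin (n + 1) → Bool) → Prop) :
    fibCard (n + 1) (fun b => FirstZero b ∧ P b) = fibCard n (fun b => P (Fin.cons false b)) := by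
  rw [fibCard_succ]
  simp only [firstZero_cons_iff, true_and]
  rw [fibCard_false (P := fun b => FirstZero b ∧ true = false ∧ P (Fin.cons true b)) (by simp),
    add_zero]

/-- The recurrence obtained by deleting a leading `0` or `10`. -/
theorem fibCard_add_two {n : ℕ} (P : (Fin (n + 2) → Bool) → Prop) :
    fibCard (n + 2) P = fibCard (n + 1) (fun b => P (Fin.cons false b)) +
      fibCard n (fun b => P (Fin.cons true (Fin.cons false b))) := by
  rw [fibCard_succ, fibCard_succ_firstZero]

theorem fibCard_zero {P : (Fin 0 → Bool) → Prop} (h : ∀ b, P b) : fibCard 0 P = 1 := by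
  unfold fibCard
  rw [Nat.card_eq_one_iff_unique]
  exact ⟨⟨fun a b => Subtype.ext (Subsingleton.elim _ _)⟩,
    ⟨⟨fun i => i.elim0, fun i => i.elim0, h _⟩⟩⟩

theorem fibCard_true (n : ℕ) : fibCard n (fun _ => True) = Nat.fib (n + 2) := by
  induction n using Nat.twoStepInduction with
  | zero => exact fibCard_zero fun _ => trivial
  | one =>
    rw [fibCard_succ, fibCard_zero (fun _ => trivial),
      fibCard_zero fun _ => ⟨fun i => i.elim0, trivial⟩]
    rfl
  | more n h1 h2 => rw [fibCard_add_two, h1, h2, Nat.fib_add_two (n := n + 2), add_comm]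

theorem fibCard_firstZero (n : ℕ) : fibCard n FirstZero = Nat.fib (n + 1) := by
  cases n with
  | zero => exact fibCard_zero fun _ i => i.elim0
  | succ n =>
    have h := fibCard_succ_firstZero (n := n) fun _ => True
    simp only [and_true] at h
    exact h.trans (fibCard_true n)

theorem fibCard_lastZero (n : ℕ) : fibCard n LastZero = Nat.fib (n + 1) := by
  induction n using Nat.twoStepInduction with
  | zero => exact fibCard_zero fun _ i => i.elim0
  | one =>
    rw [fibCard_succ, fibCard_zero, fibCard_false]
    · rfl
    · intro b h; simpa using h.2 0 rfl
    · intro b i _; simp [Fin.eq_zero i]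
  | more n h1 h2 =>
    rw [fibCard_add_two, Nat.fib_add_two (n := n + 1), ← h1, ← h2, add_comm]
    congr 1
    -- `lastZero_cons_iff` needs a nonempty tail; for `n = 0` the zero of the deleted `10` is itself
    -- the last bit.
    · cases n with
      | zero =>
        rw [fibCard_zero, fibCard_zero]
        · exact fun b i => i.elim0
        · intro b
          rw [lastZero_cons_iff]
          intro i _; simp [Fin.eq_zero i]
      | succ n => simp only [lastZero_cons_iff]
    · simp only [lastZero_cons_iff]

/-- The case `n = 0` is exceptional: the empty string is counted once, while `F_0 = 0`. -/
theorem fibCard_firstZero_lastZero (n : ℕ) (hn : n ≠ 0) :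
    fibCard n (fun b => FirstZero b ∧ LastZero b) = Nat.fib n := by
  obtain ⟨n, rfl⟩ := Nat.exists_eq_succ_of_ne_zero hn
  rw [Nat.succ_eq_add_one, fibCard_succ_firstZero, ← fibCard_lastZero]
  cases n with
  | zero =>
    rw [fibCard_zero, fibCard_zero]
    · exact fun b i => i.elim0
    · intro b i _; simp [Fin.eq_zero i]
  | succ n => simp only [lastZero_cons_iff]

/-- A one at `i` (counted from 0) forces zeros beside it: the `i` bits on its left end in zero, the
`n - i - 1` on its right begin with zero, and the two sides are independent. The induction verifies
this product through the recurrence. -/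
theorem fibCard_apply_eq_true (n : ℕ) (i : Fin n) :
    fibCard n (fun b => b i = true) = Nat.fib (i + 1) * Nat.fib (n - i) := by
  induction n using Nat.twoStepInduction with
  | zero => exact i.elim0
  | one =>
    rw [Fin.eq_zero i, fibCard_succ, fibCard_false (by simp), fibCard_zero]
    · rfl
    · exact fun b => ⟨fun i => i.elim0, by simp⟩
  | more n h1 h2 =>
    refine Fin.cases ?_ (fun i => ?_) i
    · rw [fibCard_succ, fibCard_false (by simp), zero_add]
      simp only [Fin.cons_zero, and_true]
      rw [fibCard_firstZero]
      simp
    · refine Fin.cases ?_ (fun i => ?_) i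
      · rw [fibCard_add_two]
        rw [fibCard_false (n := n) (by simp), add_zero]
        simp only [Fin.cons_succ]
        rw [h2]
        simp
      · rw [fibCard_add_two]
        simp only [Fin.cons_succ]
        simp only [h2, h1, Fin.val_succ]
        rw [Nat.fib_add_two (n := i + 1),
          show n + 2 - (i + 1 + 1) = n - i by omega, show n + 1 - (i + 1) = n - i by omega]
        ring

theorem fibCard_add_fibCard_not (n : ℕ) (P : (Fin n → Bool) → Prop) :
    fibCard n P + fibCard n (fun b => ¬ P b) = fibCard n (fun _ => True) := by
  classical
  simp only [fibCard, Nat.card_eq_fintype_card, Fintype.card_subtype, and_true]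
  rw [← Finset.filter_filter, ← Finset.filter_filter]
  exact Finset.card_filter_add_card_filter_not _

/-- Subtract the previous count from `F_{n+2} = F_{i+1} F_{n-i} + F_{i+2} F_{n-i+1}`. -/
theorem fibCard_apply_eq_false (n : ℕ) (i : Fin n) :
    fibCard n (fun b => b i = false) = Nat.fib (i + 2) * Nat.fib (n - i + 1) := by
  have h := fibCard_add_fibCard_not n (fun b => b i = true)
  simp only [Bool.not_eq_true] at h
  rw [fibCard_apply_eq_true, fibCard_true] at h
  have h2 := Nat.fib_add (i + 1) (n - i)
  rw [show (i : ℕ) + 1 + (n - i) + 1 = n + 2 by omega] at h2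
  rw [h2] at h
  exact Nat.add_left_cancel h

/-! ### Counting Lucas strings -/

theorem lucasNumber_succ (n : ℕ) : lucasNumber (n + 1) = Nat.fib n + Nat.fib (n + 2) := by
  induction n using Nat.twoStepInduction with
  | zero => rfl
  | one => rfl
  | more n h1 h2 =>
    rw [lucasNumber, h1, h2, Nat.fib_add_two (n := n + 2),
      Nat.fib_add_two (n := n + 1), Nat.fib_add_two (n := n)]
    ring

/-- Addition in `Fin (n + 1)` wraps around, so the condition on the end bits becomes one more
adjacency and rotation invariance is visible. For length 1, `i + 1 = i` excludes the string `1`, as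
required. -/
theorem isLucasString_iff_cyclic {n : ℕ} (b : Fin (n + 1) → Bool) :
    IsLucasString b ↔ ∀ i, ¬ (b i = true ∧ b (i + 1) = true) := by
  constructor
  · rintro ⟨h1, h2⟩ i
    by_cases hi : i = Fin.last n
    · subst hi
      rw [Fin.last_add_one, and_comm]
      exact h2 0 (Fin.last n) rfl rfl
    · exact h1 i (i + 1) (Fin.val_add_one_of_lt (Fin.lt_last_iff_ne_last.2 hi))
  · intro h
    refine ⟨fun i j hij => ?_, fun i j hi hj => ?_⟩
    · have : j = i + 1 := by
        ext
        rw [hij, Fin.val_add_one_of_lt]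
        rw [Fin.lt_def, Fin.val_last]; omega
      rw [this]; exact h i
    · have h1 : i = 0 := Fin.ext hi
      have h2 : j = Fin.last n := Fin.ext (by simpa using hj)
      have := h (Fin.last n)
      rw [Fin.last_add_one, and_comm] at this
      rw [h1, h2]; exact this

theorem card_lucas_apply_eq (n : ℕ) (i : Fin (n + 1)) (t : Bool) :
    Nat.card {b : Fin (n + 1) → Bool // IsLucasString b ∧ b i = t} =
      Nat.card {b : Fin (n + 1) → Bool // IsLucasString b ∧ b 0 = t} := by
  refine Nat.card_congr (Equiv.subtypeEquiv
    ((Equiv.addRight i).symm.arrowCongr (Equiv.refl Bool)) fun b => ?_)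
  refine and_congr ?_ (by simp)
  rw [isLucasString_iff_cyclic, isLucasString_iff_cyclic]
  refine ((Equiv.addRight i).forall_congr fun j => ?_).symm
  simp [add_right_comm]

theorem isLucasString_cons_iff {n : ℕ} (t : Bool) (b : Fin (n + 1) → Bool) :
    IsLucasString (Fin.cons t b : Fin (n + 2) → Bool) ↔
      IsFibonacciString b ∧ (t = true → FirstZero b ∧ LastZero b) := by
  unfold IsLucasString
  rw [isFibonacciString_cons_iff, and_assoc]
  refine and_congr_right fun _ => ?_
  rw [imp_and]
  refine and_congr Iff.rfl ⟨fun h ht j hj => ?_, fun h i j hi hj => ?_⟩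
  · simpa [ht] using h 0 j.succ rfl (by simp [hj])
  · have hi0 : i = 0 := Fin.ext hi
    subst hi0
    obtain ⟨j, rfl⟩ : ∃ k, j = Fin.succ k :=
      ⟨j.pred (fun h => by rw [h] at hj; simp at hj), by simp⟩
    rintro ⟨ht, hj'⟩
    have := h (by simpa using ht) j (by simpa using hj)
    simp [this] at hj'

theorem card_lucas_apply_eq_true (n : ℕ) (i : Fin (n + 1)) :
    Nat.card {b : Fin (n + 1) → Bool // IsLucasString b ∧ b i = true} = Nat.fib n := by
  rw [card_lucas_apply_eq]
  cases n with
  | zero =>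
    rw [Nat.fib_zero, Nat.card_eq_zero]
    refine Or.inl ⟨fun b => ?_⟩
    exact b.2.1.2 0 0 rfl rfl ⟨b.2.2, b.2.2⟩
  | succ n =>
    rw [card_subtype_fin_succ, ← fibCard_firstZero_lastZero (n + 1) (by omega)]
    simp [isLucasString_cons_iff, fibCard]

theorem card_lucas_apply_eq_false (n : ℕ) (i : Fin (n + 1)) :
    Nat.card {b : Fin (n + 1) → Bool // IsLucasString b ∧ b i = false} = Nat.fib (n + 2) := by
  rw [card_lucas_apply_eq]
  cases n with
  | zero =>
    rw [show Nat.fib (0 + 2) = 1 from rfl, Nat.card_eq_one_iff_unique]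
    refine ⟨⟨fun a b => Subtype.ext (funext fun j => ?_)⟩, ⟨⟨fun _ => false, ?_, rfl⟩⟩⟩
    · rw [Fin.eq_zero j, a.2.2, b.2.2]
    · exact ⟨fun _ _ _ => by simp, fun _ _ _ _ => by simp⟩
  | succ n =>
    rw [card_subtype_fin_succ, ← fibCard_true (n + 1)]
    simp [isLucasString_cons_iff, fibCard]

/-! ### The Fibonacci convolution -/

/-- A closed form for the self-convolution of the sequence of products of consecutive Fibonacci numbers. -/
theorem sum_fib_mul_fib_convolution (n : ℕ) :
    25 * ∑ i ∈ Finset.range n, ((Nat.fib (i + 1) * Nat.fib (i + 2) *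
        (Nat.fib (n - i) * Nat.fib (n - i + 1)) : ℕ) : ℚ) =
      4 * ((n : ℚ) + 1) * (Nat.fib n : ℚ) ^ 2 +
        (9 * (n : ℚ) + 2) * (Nat.fib n : ℚ) * (Nat.fib (n + 1) : ℚ) +
        6 * (n : ℚ) * (Nat.fib (n + 1) : ℚ) ^ 2 := by
  obtain ⟨p, hp⟩ : ∃ p : ℕ → ℚ, ∀ k, p k = (Nat.fib k : ℚ) * Nat.fib (k + 1) := ⟨_, fun _ => rfl⟩
  have hrec : ∀ k, p (k + 3) = 2 * p (k + 2) + 2 * p (k + 1) - p k := by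
    intro k
    simp only [hp, Nat.fib_add_two (n := k), Nat.fib_add_two (n := k + 1),
      Nat.fib_add_two (n := k + 2)]
    push_cast
    ring
  have hs : ∀ n : ℕ, ∑ i ∈ Finset.range n, ((Nat.fib (i + 1) * Nat.fib (i + 2) *
        (Nat.fib (n - i) * Nat.fib (n - i + 1)) : ℕ) : ℚ) =
      ∑ i ∈ Finset.range n, p (i + 1) * p (n - i) := by
    intro n
    refine Finset.sum_congr rfl fun i _ => ?_
    rw [hp, hp]; push_cast; ring
  rw [hs]
  obtain ⟨s, hsdef⟩ : ∃ s : ℕ → ℚ, ∀ n, s n = ∑ i ∈ Finset.range n, p (i + 1) * p (n - i) :=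
    ⟨_, fun _ => rfl⟩
  rw [← hsdef]
  have hp1 : p 1 = 1 := by rw [hp]; norm_num [Nat.fib_add_two]
  have hp2 : p 2 = 2 := by rw [hp]; norm_num [Nat.fib_add_two]
  have hp3 : p 3 = 6 := by rw [hp]; norm_num [Nat.fib_add_two]
  -- The convolution inherits the recurrence of `p`. Among the boundary terms, the coefficients of
  -- `p (n + 1)` and `p (n + 2)` are `6 - 4 - 2 = 0` and `2 - 2 = 0`, so only `p (n + 3)` survives.
  have hsrec : ∀ n, s (n + 3) = 2 * s (n + 2) + 2 * s (n + 1) - s n + p (n + 3) := by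
    intro n
    have h : ∑ i ∈ Finset.range n, p (i + 1) * p (n + 3 - i) =
        2 * ∑ i ∈ Finset.range n, p (i + 1) * p (n + 2 - i) +
        2 * ∑ i ∈ Finset.range n, p (i + 1) * p (n + 1 - i) -
        ∑ i ∈ Finset.range n, p (i + 1) * p (n - i) := by
      rw [Finset.mul_sum, Finset.mul_sum, ← Finset.sum_add_distrib, ← Finset.sum_sub_distrib]
      refine Finset.sum_congr rfl fun i hi => ?_
      have hin := Finset.mem_range.1 hi
      rw [show n + 3 - i = n - i + 3 by omega, show n + 2 - i = n - i + 2 by omega,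
        show n + 1 - i = n - i + 1 by omega, hrec]
      ring
    simp only [hsdef, Finset.sum_range_succ]
    rw [h, show n + 3 - n = 3 by omega, show n + 3 - (n + 1) = 2 by omega,
      show n + 3 - (n + 2) = 1 by omega, show n + 2 - n = 2 by omega,
      show n + 2 - (n + 1) = 1 by omega, show n + 1 - n = 1 by omega, hp1, hp2, hp3]
    ring
  -- The recurrence has order three, so the induction carries three consecutive values.
  have hind : ∀ n : ℕ, ∀ m, m = n ∨ m = n + 1 ∨ m = n + 2 →
      25 * s m = 4 * ((m : ℚ) + 1) * (Nat.fib m : ℚ) ^ 2 +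
        (9 * (m : ℚ) + 2) * (Nat.fib m : ℚ) * (Nat.fib (m + 1) : ℚ) +
        6 * (m : ℚ) * (Nat.fib (m + 1) : ℚ) ^ 2 := by
    intro n
    induction n with
    | zero =>
      rintro m (rfl | rfl | rfl)
      · simp [hsdef]
      · norm_num [hsdef, hp1]
      · norm_num [hsdef, hp1, hp2, Finset.sum_range_succ, Nat.fib_add_two]
    | succ n ih =>
      rintro m (rfl | rfl | rfl)
      · exact ih _ (by omega)
      · exact ih _ (by omega)
      · have h0 := ih n (by omega)
        have h1 := ih (n + 1) (by omega)
        have h2 := ih (n + 2) (by omega)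
        have h3 := hsrec n
        rw [hp] at h3
        rw [show n + 1 + 2 = n + 3 by omega]
        simp only [Nat.fib_add_two (n := n), Nat.fib_add_two (n := n + 1),
          Nat.fib_add_two (n := n + 2)] at h0 h1 h2 h3 ⊢
        push_cast at h0 h1 h2 h3 ⊢
        linear_combination 25 * h3 + 2 * h2 + 2 * h1 - h0
  exact hind n n (Or.inl rfl)

/-! ### Closure properties and conclusion -/

theorem isFibonacciString_of_le {n : ℕ} {x y : Fin n → Bool} (hy : IsFibonacciString y)
    (h : ∀ i, x i = true → y i = true) : IsFibonacciString x :=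
  fun i j hij hx => hy i j hij ⟨h i hx.1, h j hx.2⟩

theorem isLucasString_of_le {n : ℕ} {x y : Fin n → Bool} (hy : IsLucasString y)
    (h : ∀ i, x i = true → y i = true) : IsLucasString x :=
  ⟨isFibonacciString_of_le hy.1 h, fun i j hi hj hx => hy.2 i j hi hj ⟨h i hx.1, h j hx.2⟩⟩

/-- Pigeonhole: two of the three strings would have a one at `i` and two at `j`, so some string
would have both. -/
theorem not_majority_and_majority {n : ℕ} {x y z : Fin n → Bool} {i j : Fin n}
    (hx : ¬ (x i = true ∧ x j = true)) (hy : ¬ (y i = true ∧ y j = true))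
    (hz : ¬ (z i = true ∧ z j = true)) :
    ¬ (majority x y z i = true ∧ majority x y z j = true) := by
  simp only [majority, Bool.or_eq_true, Bool.and_eq_true]
  tauto

theorem IsFibonacciString.majority {n : ℕ} {x y z : Fin n → Bool} (hx : IsFibonacciString x)
    (hy : IsFibonacciString y) (hz : IsFibonacciString z) :
    IsFibonacciString (majority x y z) :=
  fun i j hij => not_majority_and_majority (hx i j hij) (hy i j hij) (hz i j hij)

theorem IsLucasString.majority {n : ℕ} {x y z : Fin n → Bool} (hx : IsLucasString x)
    (hy : IsLucasString y) (hz : IsLucasString z) : IsLucasString (majority x y z) :=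
  ⟨hx.1.majority hy.1 hz.1, fun i j hi hj =>
    not_majority_and_majority (hx.2 i j hi hj) (hy.2 i j hi hj) (hz.2 i j hi hj)⟩

theorem isLucasString_zero (n : ℕ) : IsLucasString (fun _ : Fin n => false) :=
  ⟨fun _ _ _ => by simp, fun _ _ _ _ => by simp⟩

theorem mainTheorem3 :
    (∀ n : ℕ, (fibonacciCube n).Connected ∧
      (steinerWienerIndex 3 (fibonacciCube n) : ℚ) =
        1 / 50 * ((Nat.fib (n + 2) : ℚ) - 2) *
          (4 * ((n : ℚ) + 1) * (Nat.fib n : ℚ) ^ 2 +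
            (9 * (n : ℚ) + 2) * (Nat.fib n : ℚ) * (Nat.fib (n + 1) : ℚ) +
            6 * (n : ℚ) * (Nat.fib (n + 1) : ℚ) ^ 2)) ∧
    (∀ n : ℕ, 1 ≤ n → (lucasCube n).Connected ∧
      (steinerWienerIndex 3 (lucasCube n) : ℚ) =
        (n : ℚ) / 2 * (Nat.fib (n - 1) : ℚ) * (Nat.fib (n + 1) : ℚ) *
          ((lucasNumber n : ℚ) - 2)) := by
  refine ⟨fun n => ⟨?_, ?_⟩, fun n hn => ⟨?_, ?_⟩⟩
  · exact induce_nCube_connected (fun x y hy h => isFibonacciString_of_le hy h)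
      ⟨_, (isLucasString_zero n).1⟩
  · have h := two_mul_steinerWienerIndex_three (P := {b : Fin n → Bool | IsFibonacciString b})
      (fun x y hy h => isFibonacciString_of_le hy h)
      (fun x y z hx hy hz => IsFibonacciString.majority hx hy hz) _ _
      (fibCard_apply_eq_true n) (fibCard_apply_eq_false n)
    -- The two counts add up to `F_{n+2}` for every `i`, so the last factor is constant and leaves
    -- the sum.
    have hterm : ∀ i : Fin n, (((Nat.fib (i + 1) * Nat.fib (n - i) : ℕ) : ℚ)) *
        ((Nat.fib (i + 2) * Nat.fib (n - i + 1) : ℕ) : ℚ) *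
        (((Nat.fib (i + 1) * Nat.fib (n - i) : ℕ) : ℚ) +
          ((Nat.fib (i + 2) * Nat.fib (n - i + 1) : ℕ) : ℚ) - 2) =
        ((Nat.fib (i + 1) * Nat.fib (i + 2) *
          (Nat.fib (n - i) * Nat.fib (n - i + 1)) : ℕ) : ℚ) * ((Nat.fib (n + 2) : ℚ) - 2) := by
      intro i
      have h2 := Nat.fib_add (i + 1) (n - i)
      rw [show (i : ℕ) + 1 + (n - i) + 1 = n + 2 by omega] at h2
      rw [h2]
      push_cast
      ring
    rw [Finset.sum_congr rfl fun i _ => hterm i, ← Finset.sum_mul,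
      Fin.sum_univ_eq_sum_range (fun i => ((Nat.fib (i + 1) * Nat.fib (i + 2) *
          (Nat.fib (n - i) * Nat.fib (n - i + 1)) : ℕ) : ℚ))] at h
    rw [← sum_fib_mul_fib_convolution]
    unfold fibonacciCube
    linear_combination h / 2
  · exact induce_nCube_connected (fun x y hy h => isLucasString_of_le hy h)
      ⟨_, isLucasString_zero n⟩
  · obtain ⟨n, rfl⟩ := Nat.exists_eq_add_of_le' hn
    have h := two_mul_steinerWienerIndex_three (P := {b : Fin (n + 1) → Bool | IsLucasString b})
      (fun x y hy h => isLucasString_of_le hy h)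
      (fun x y z hx hy hz => IsLucasString.majority hx hy hz) _ _
      (card_lucas_apply_eq_true n) (card_lucas_apply_eq_false n)
    rw [Finset.sum_const, Finset.card_univ, Fintype.card_fin, nsmul_eq_mul] at h
    rw [lucasNumber_succ, Nat.add_sub_cancel]
    unfold lucasCube
    push_cast at h ⊢
    linear_combination h / 2
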